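/- **Theorem (practical asymptotic stability of EDMD-based MPC).** *System.* Let $g_0,\dots,g_m:\mathbb R^n\to\mathbb R^n$ be locally Lipschitz with $g_0(0)=0$, let $\mathbb X\subset\mathbb R^n$ and $\mathbb U\subset\mathbb R^m$ be compact with $(0,0)\in\operatorname{int}(\mathbb X\times\mathbb U)$, and let $\Delta t>0$. For $x\in\mathbb X$, $u\in\mathbb U$ suppose that the solution $x(\cdot;x,u)$ of $\dot x=g_0(x)+\sum_{i=1}^m u_i g_i(x)$, $x(0)=x$, with constant $u$ exists on $[0,\Delta t]$, and put $f(x,u):=x(\Delta t;x,u)$. *Dictionary.* Let $\Psi=(\psi_1,\dots,\psi_M)=(1,x_1,\dots,x_n,\psi_{n+2},\dots,\psi_M)$, where for $k\ge n+2$ the function $\psi_k\in C^1(\mathbb R^n)$ satisfies $\psi_k(0)=0$, $D\psi_k(0)=0$; let the $\psi_k$ be linearly independent on $\mathbb X$ and let $\mathbb V$ be their span. Assume that $\mathbb V$ is invariant: for all $\varphi\in\mathbb V$ and $u\in\mathbb U$, the function $x\mapsto\varphi(f(x,u))$ on $\mathbb X$ belongs to $\mathbb V$. Let $K_u\in\mathbb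 R^{M\times M}$ be the matrix of the Koopman operator on $\mathbb V$, i.e. $\Psi(f(x,u))=K_u\Psi(x)$ for $x\in\mathbb X$. *Surrogates.* Let $\varepsilon_0>0$. For each $\varepsilon\in(0,\varepsilon_0]$ let finitely many samples $x_1,\dots,x_d\in\mathbb X$ be given (depending on $\varepsilon$), let $L^{e_i}$, $i=1,\dots,m$, be a minimizer of $\|LX-Y_{e_i}\|_F$ over $L\in\mathbb R^{M\times M}$ and let $L^0$ be a minimizer of $\|LX-Y_0\|_F$ over all $L$ with vanishing first column, where $X=(\psi_k(x_j))_{k,j}$ and $Y_u=(\nabla\psi_k(x_j)^\top(g_0(x_j)+\sum_i u_i g_i(x_j)))_{k,j}$. Put $L^u:=L^0+\sum_i u_i(L^{e_i}-L^0)$ and $f^\varepsilon(x,u):=P_x e^{\Delta t L^u}\Psi(x)$, where $P_x$ selects the components belonging to the observables $x_1,\dots,x_n$. Assume the operator error bound $\|K_u-e^{\Delta t L^u}\|\le\varepsilon$ (spectral norm) for all $u\in\mathbb U$ and all $\varepsilon\in(0,\varepsilon_0]$. *MPC.* Let $\ell(x,u)=x^\top Qx+u^\top Ru$ with symmetric positive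 definite $Q,R$, let $\ell^\star(x)=\inf_{u\in\mathbb U}\ell(x,u)$, and let $N\ge2$. For dynamics $F$ write $x^F_u(k;x)$ for the trajectory with initial value $x$ and controls $u=(u(k))_k$, and $J^F_k(x,u)=\sum_{j=0}^{k-1}\ell(x^F_u(j;x),u(j))$. A control sequence of length $N$ with values in $\mathbb U$ is admissible at $x$ for $(F,Y)$ if $x^F_u(k;x)\in Y$ for $k=1,\dots,N$. Let $\mathcal U_N(x)$ and $\mathcal U_N^\varepsilon(x)$ be the sets of sequences admissible for $(f,\mathbb X)$ and $(f^\varepsilon,\mathbb X\ominus\mathcal B_\varepsilon(0))$, respectively, where $A\ominus\mathcal B_\rho(0)=\{x: x+b\in A\ \text{for all}\ \|b\|<\rho\}$. At $x$, the EDMD-based MPC computes a minimizer $u^{\varepsilon,x}$ of $J_N^{f^\varepsilon}(x,\cdot)$ over $\mathcal U_N^\varepsilon(x)$ and applies $\mu_N^\varepsilon(x):=u^{\varepsilon,x}(0)$. *Assumptions.* Let $S\subseteq\mathbb X\ominus\mathcal B_{\varepsilon_0}(0)$ contain the origin in its interior, and let $\eta>0$ be such that for all $\varepsilon\in(0,\varepsilon_0]$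 and all $x\in S$: 1. the minimizer $u^{\varepsilon,x}$ exists, and some minimizer $u^\star\in\mathcal U^\varepsilon_N(x)$ satisfies $x^{f^\varepsilon}_{u^\star}(k;x)\in\mathbb X\ominus\mathcal B_{\varepsilon+\eta}(0)$ for $k=0,\dots,N$; 2. $S$ is forward invariant with margin for the surrogate closed loop: $f^\varepsilon(x,\mu^\varepsilon_N(x))\in S\ominus\mathcal B_\eta(0)$; 3. (cost controllability) there is a non-decreasing bounded real sequence $(B_k)_{k\ge1}$, independent of $\varepsilon$ and $x$, such that for every state $z=x^{f^\varepsilon}_{u^{\varepsilon,x}}(j;x)$, $j=0,\dots,N-1$ (in particular for $z=x$), there is $\hat u\in\mathcal U_N(z)\cap\mathcal U_N^\varepsilon(z)$ with $J_k^{f}(z,\hat u)\le B_k\,\ell^\star(z)$ for $k=1,\dots,N$. Finally let $$\alpha_N:=1-\frac{(B_2-1)(B_N-1)\prod_{i=3}^N(B_i-1)}{\prod_{i=2}^N B_i-(B_2-1)\prod_{i=3}^N(B_i-1)}\in(0,1).$$ *Conclusion.* The origin is semi-globally practically asymptotically stable on $S$ with respect to $\varepsilon$ for the true system under the EDMD-based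 MPC feedback: there is $\beta\in\mathcal{KL}$ such that for all $R>r>0$ there is $\varepsilon_1>0$ such that for all $\hat x\in S$ with $\|\hat x\|\le R$ and all $\varepsilon\in(0,\min\{\varepsilon_0,\varepsilon_1\}]$ the solution of $x(k+1)=f(x(k),\mu_N^\varepsilon(x(k)))$, $x(0)=\hat x$, satisfies $x(k)\in S$ and $\|x(k)\|\le\max\{\beta(\|\hat x\|,k),r\}$ for all $k\in\mathbb N_0$. -/

import Mathlib

noncomputable section

namespace EDMDMPC

/-- `ℝⁿ` with the Euclidean norm (used for states and for control values). -/
abbrev Vec (n : ℕ) : Type := EuclideanSpace ℝ (Fin n)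

/-! ### Control-affine systems and their sampled-data representation -/

/-- A control-affine system `x' = g₀ x + ∑ i, uᵢ • gᵢ x` with locally Lipschitz maps
and equilibrium `g₀ 0 = 0`. -/
structure ControlAffineSystem (n m : ℕ) where
  g₀ : Vec n → Vec n
  g : Fin m → Vec n → Vec n
  locallyLipschitz_g₀ : LocallyLipschitz g₀
  locallyLipschitz_g : ∀ i, LocallyLipschitz (g i)
  equilibrium : g₀ 0 = 0

namespace ControlAffineSystem

variable {n m : ℕ} (sys : ControlAffineSystem n m)

/-- The vector field for a constant control value. -/
def vectorField (u : Vec m) (x : Vec n) : Vec n := sys.g₀ x + ∑ i, u i • sys.g i x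

/-- `γ` solves the initial value problem on `[0, Δt]` for the constant control value `u`. -/
def IsSolution (Δt : ℝ) (x : Vec n) (u : Vec m) (γ : ℝ → Vec n) : Prop :=
  γ 0 = x ∧ ∀ t ∈ Set.Icc 0 Δt,
    HasDerivWithinAt γ (sys.vectorField u (γ t)) (Set.Icc 0 Δt) t

open Classical in
/-- The sampled-data map `f(x, u) = x(Δt; x, u)` (zero-order hold): the value at time `Δt` of the
solution, which is unique since the vector field is locally Lipschitz.  The default value `0` is
used only where no solution exists on `[0, Δt]`. -/
def sampled (Δt : ℝ) (x : Vec n) (u : Vec m) : Vec n :=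
  if h : ∃ γ, sys.IsSolution Δt x u γ then h.choose Δt else 0

end ControlAffineSystem

/-! ### Dictionary, Koopman matrix -/

/-- Indices of the observables: the constant one, the `n` coordinates, `p` further ones. -/
abbrev ObsIdx (n p : ℕ) : Type := Unit ⊕ Fin n ⊕ Fin p

/-- A dictionary, given by its observables other than `1, x₁, …, xₙ`. -/
structure Dictionary (n p : ℕ) where
  extra : Fin p → Vec n → ℝ
  contDiff_extra : ∀ k, ContDiff ℝ 1 (extra k)
  extra_zero : ∀ k, extra k 0 = 0
  fderiv_extra_zero : ∀ k, fderiv ℝ (extra k) 0 = 0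

namespace Dictionary

variable {n p : ℕ} (dict : Dictionary n p)

/-- The observables `1, x₁, …, xₙ, extra₁, …, extraₚ`. -/
def obs : ObsIdx n p → Vec n → ℝ :=
  Sum.elim (fun _ _ => 1) (Sum.elim (fun i x => x i) dict.extra)

/-- The vector-valued observable `Ψ`. -/
def Ψ (x : Vec n) : ObsIdx n p → ℝ := fun k => dict.obs k x

/-- The space `𝕍` spanned by the observables. -/
def space : Submodule ℝ (Vec n → ℝ) := Submodule.span ℝ (Set.range dict.obs)

/-- Invariance of `𝕍`: for `φ ∈ 𝕍` and `u ∈ U`, the function `φ(f(·, u))` on `X` belongs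
to `𝕍`. -/
def IsInvariant {m : ℕ} (f : Vec n → Vec m → Vec n) (X : Set (Vec n)) (U : Set (Vec m)) : Prop :=
  ∀ u ∈ U, ∀ φ ∈ dict.space, ∃ φ' ∈ dict.space, ∀ x ∈ X, φ (f x u) = φ' x

open Classical in
/-- The matrix of the Koopman operator `𝒦ᵤ φ = φ(f(·, u))` restricted to `𝕍`, in the convention
`Ψ(f(x, u)) = K Ψ(x)` on `X`.  It exists if `𝕍` is invariant and is unique if the
observables are linearly independent on `X`. -/
def koopmanMatrix {m : ℕ} (f : Vec n → Vec m → Vec n) (X : Set (Vec n)) (u : Vec m) :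
    Matrix (ObsIdx n p) (ObsIdx n p) ℝ :=
  if h : ∃ K : Matrix (ObsIdx n p) (ObsIdx n p) ℝ,
      ∀ x ∈ X, dict.Ψ (f x u) = K.mulVec (dict.Ψ x) then h.choose else 0

end Dictionary

/-! ### EDMD -/

/-- The square of the Frobenius norm. -/
def frobSq {ι κ : Type*} [Fintype ι] [Fintype κ] (A : Matrix ι κ ℝ) : ℝ := ∑ i, ∑ j, A i j ^ 2

/-- The data matrix `(ψₖ(xⱼ))`. -/
def dataX {n p d : ℕ} (dict : Dictionary n p) (xs : Fin d → Vec n) :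
    Matrix (ObsIdx n p) (Fin d) ℝ :=
  Matrix.of fun k j => dict.obs k (xs j)

/-- The data matrix `((ℒᵘ ψₖ)(xⱼ))`, where `(ℒᵘ ψ)(x) = ∇ψ(x)ᵀ (g₀(x) + ∑ i, uᵢ gᵢ(x))`. -/
def dataY {n m p d : ℕ} (sys : ControlAffineSystem n m) (dict : Dictionary n p) (u : Vec m)
    (xs : Fin d → Vec n) : Matrix (ObsIdx n p) (Fin d) ℝ :=
  Matrix.of fun k j => fderiv ℝ (dict.obs k) (xs j) (sys.vectorField u (xs j))

/-- An EDMD model learned from `d` samples in `X`: least-squares estimators `L₀` and `L i` of the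
generators for the control values `0` and `eᵢ`.  The first column of `L₀` is constrained to
vanish, so that the controlled equilibrium at the origin is preserved. -/
structure EDMDModel {n m p : ℕ} (sys : ControlAffineSystem n m) (dict : Dictionary n p)
    (X : Set (Vec n)) where
  d : ℕ
  xs : Fin d → Vec n
  xs_mem : ∀ j, xs j ∈ X
  L₀ : Matrix (ObsIdx n p) (ObsIdx n p) ℝ
  L : Fin m → Matrix (ObsIdx n p) (ObsIdx n p) ℝ
  L₀_consistent : ∀ k, L₀ k (Sum.inl ()) = 0
  L₀_min : ∀ L' : Matrix (ObsIdx n p) (ObsIdx n p) ℝ, (∀ k, L' k (Sum.inl ()) = 0) →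
    frobSq (L₀ * dataX dict xs - dataY sys dict 0 xs) ≤
      frobSq (L' * dataX dict xs - dataY sys dict 0 xs)
  L_min : ∀ (i : Fin m) (L' : Matrix (ObsIdx n p) (ObsIdx n p) ℝ),
    frobSq (L i * dataX dict xs - dataY sys dict (EuclideanSpace.single i 1) xs) ≤
      frobSq (L' * dataX dict xs - dataY sys dict (EuclideanSpace.single i 1) xs)

namespace EDMDModel

variable {n m p : ℕ} {sys : ControlAffineSystem n m} {dict : Dictionary n p} {X : Set (Vec n)}
  (E : EDMDModel sys dict X)

/-- The bilinear estimate `L₀ + ∑ i, uᵢ (L i - L₀)` of the generator for the control value `u`. -/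
def generator (u : Vec m) : Matrix (ObsIdx n p) (ObsIdx n p) ℝ :=
  E.L₀ + ∑ i, u i • (E.L i - E.L₀)

/-- The estimate `exp(Δt L(u))` of the Koopman matrix. -/
def propagator (Δt : ℝ) (u : Vec m) : Matrix (ObsIdx n p) (ObsIdx n p) ℝ :=
  NormedSpace.exp (Δt • E.generator u)

/-- The surrogate dynamics `Pₓ exp(Δt L(u)) Ψ(x)`, with `Pₓ` the projection onto the
components belonging to the coordinate observables. -/
def surrogate (Δt : ℝ) (x : Vec n) (u : Vec m) : Vec n :=
  WithLp.toLp 2 fun i => (E.propagator Δt u).mulVec (dict.Ψ x) (Sum.inr (Sum.inl i))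

/-- The operator error bound: on `U`, the Koopman matrix and its estimate differ by at most `ε`
in the spectral norm. -/
def OperatorBound (Δt : ℝ) (U : Set (Vec m)) (ε : ℝ) : Prop :=
  ∀ u ∈ U, ‖Matrix.toEuclideanCLM (𝕜 := ℝ)
    (dict.koopmanMatrix (sys.sampled Δt) X u - E.propagator Δt u)‖ ≤ ε

end EDMDModel

/-! ### Model predictive control -/

section MPC

variable {n m : ℕ}

/-- The solution of `x⁺ = F(x, u)` for a sequence of control values. -/
def traj (F : Vec n → Vec m → Vec n) (u : ℕ → Vec m) (x : Vec n) : ℕ → Vec n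
  | 0 => x
  | k + 1 => F (traj F u x k) (u k)

/-- Admissibility over the horizon `N`, for the state constraint `Y` and the control
constraint `U`; only the first `N` values of the sequence `u` matter. -/
def Admissible (F : Vec n → Vec m → Vec n) (Y : Set (Vec n)) (U : Set (Vec m)) (N : ℕ)
    (x : Vec n) (u : ℕ → Vec m) : Prop :=
  (∀ k < N, u k ∈ U) ∧ ∀ k ∈ Finset.Icc 1 N, traj F u x k ∈ Y

/-- The quadratic stage cost `xᵀ Q x + uᵀ R u`. -/
def stageCost (Q : Matrix (Fin n) (Fin n) ℝ) (R : Matrix (Fin m) (Fin m) ℝ)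
    (x : Vec n) (u : Vec m) : ℝ :=
  dotProduct x.ofLp (Q.mulVec x.ofLp) + dotProduct u.ofLp (R.mulVec u.ofLp)

/-- `ℓ⋆(x) = inf_{u ∈ U} ℓ(x, u)`. -/
def minStageCost (Q : Matrix (Fin n) (Fin n) ℝ) (R : Matrix (Fin m) (Fin m) ℝ)
    (U : Set (Vec m)) (x : Vec n) : ℝ :=
  ⨅ u : U, stageCost Q R x u

/-- The cost `J_N(x, u)` over the horizon `N`. -/
def cost (F : Vec n → Vec m → Vec n) (Q : Matrix (Fin n) (Fin n) ℝ) (R : Matrix (Fin m) (Fin m) ℝ)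
    (N : ℕ) (x : Vec n) (u : ℕ → Vec m) : ℝ :=
  ∑ k ∈ Finset.range N, stageCost Q R (traj F u x k) (u k)

/-- `u` solves the optimal control problem with horizon `N` and initial value `x`. -/
def IsOptimal (F : Vec n → Vec m → Vec n) (Q : Matrix (Fin n) (Fin n) ℝ)
    (R : Matrix (Fin m) (Fin m) ℝ) (Y : Set (Vec n)) (U : Set (Vec m)) (N : ℕ)
    (x : Vec n) (u : ℕ → Vec m) : Prop :=
  Admissible F Y U N x u ∧ ∀ v, Admissible F Y U N x v → cost F Q R N x u ≤ cost F Q R N x v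

/-- The Pontryagin difference `A ⊖ B_ρ(0)`. -/
def tighten (A : Set (Vec n)) (ρ : ℝ) : Set (Vec n) :=
  {x | ∀ b ∈ Metric.ball (0 : Vec n) ρ, x + b ∈ A}

/-- The growth bound of cost controllability at the state `x`: some control sequence that is
admissible both for `f` (with constraint `X`) and for `F` (with constraint `Y`) satisfies
`J_k(x, u) ≤ B_k ℓ⋆(x)` for the true dynamics `f`.  (The inequality `V_k(x) ≤ J_k(x, u)` is
automatic, as `u` is admissible.) -/
def CostControllableAt (f F : Vec n → Vec m → Vec n) (Q : Matrix (Fin n) (Fin n) ℝ)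
    (R : Matrix (Fin m) (Fin m) ℝ) (X Y : Set (Vec n)) (U : Set (Vec m)) (N : ℕ) (B : ℕ → ℝ)
    (x : Vec n) : Prop :=
  ∃ u : ℕ → Vec m, Admissible f X U N x u ∧ Admissible F Y U N x u ∧
    ∀ k ∈ Finset.Icc 1 N, cost f Q R k x u ≤ B k * minStageCost Q R U x

/-- The suboptimality index `α_N` (with `ω = 1`). -/
def subopt (B : ℕ → ℝ) (N : ℕ) : ℝ :=
  1 - ((B 2 - 1) * (B N - 1) * ∏ i ∈ Finset.Icc 3 N, (B i - 1)) /
    (∏ i ∈ Finset.Icc 2 N, B i - (B 2 - 1) * ∏ i ∈ Finset.Icc 3 N, (B i - 1))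

end MPC

/-! ### Practical asymptotic stability -/

/-- Comparison functions of class `𝒦ℒ` on `[0, ∞) × [0, ∞)`. -/
structure IsClassKL (β : ℝ → ℝ → ℝ) : Prop where
  continuousOn : ContinuousOn (fun q : ℝ × ℝ => β q.1 q.2) (Set.Ici 0 ×ˢ Set.Ici 0)
  zero : ∀ t, 0 ≤ t → β 0 t = 0
  strictMonoOn : ∀ t, 0 ≤ t → StrictMonoOn (fun s => β s t) (Set.Ici 0)
  strictAntiOn : ∀ s, 0 < s → StrictAntiOn (β s) (Set.Ici 0)
  tendsto : ∀ s, 0 < s → Filter.Tendsto (β s) Filter.atTop (nhds 0)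

/-- Semi-global practical asymptotic stability of the origin on `A` with respect to the
parameter `ε`, for the family `x(k + 1) = step ε (x(k))`. -/
def SemigloballyPracticallyAsymptoticallyStable {n : ℕ} (step : ℝ → Vec n → Vec n)
    (A : Set (Vec n)) : Prop :=
  ∃ β : ℝ → ℝ → ℝ, IsClassKL β ∧ ∀ r > 0, ∀ R > r, ∃ ε₁ > 0,
    ∀ x ∈ A, ‖x‖ ≤ R → ∀ ε ∈ Set.Ioc 0 ε₁, ∀ k : ℕ,
      (step ε)^[k] x ∈ A ∧ ‖(step ε)^[k] x‖ ≤ max (β ‖x‖ k) r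

end EDMDMPC

end

/-! The optimal surrogate cost `V ε x = cost (F ε) Q R N x (opt ε x)` is a practical Lyapunov
function for the true closed loop: it lies between quadratics in `‖x‖` and decreases along true
steps, up to errors of order `ε`.

Two facts about the surrogate suffice. It is `O(ε)`-close to `f` on `X`, since invariance makes `f`
the coordinate part of the Koopman matrix applied to `Ψ` (`Dictionary.eq_coordProj_koopmanMatrix`).
It is Lipschitz on `X` uniformly in `ε`, since all propagators lie close to the same Koopman
matrices. The growth bounds for `f` then carry over to the surrogate with an additive `O(ε)`.

`IsOptimal.cost_successor_le` turns these bounds into a decrease by `subopt B N` times the stage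
cost towards the surrogate successor. The true successor is `O(ε)` away; the margin `η` keeps a
minimizer of the surrogate successor admissible there, at an extra cost `O(ε)`.
`semigloballyPracticallyAsymptoticallyStable_of_lyapunov` concludes. -/

namespace EDMDMPC

/-! ### Pontryagin differences -/

section Tighten

variable {n : ℕ} {A : Set (Vec n)} {ρ σ : ℝ} {x y : Vec n}

theorem tighten_subset (hρ : 0 < ρ) : tighten A ρ ⊆ A := fun x hx => by
  simpa using hx 0 (Metric.mem_ball_self hρ)

theorem mem_tighten_of_dist_lt (hx : x ∈ tighten A (ρ + σ)) (h : ‖y - x‖ < σ) :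
    y ∈ tighten A ρ := fun b hb => by
  have hb' : ‖b‖ < ρ := by simpa using hb
  have := hx (y - x + b) (by
    rw [mem_ball_zero_iff]
    exact (norm_add_le _ _).trans_lt (by linarith))
  rwa [show x + (y - x + b) = y + b by abel] at this

theorem mem_of_mem_tighten_of_dist_lt (hx : x ∈ tighten A ρ) (h : ‖y - x‖ < ρ) : y ∈ A := by
  simpa using hx (y - x) (by simpa using h)

end Tighten

/-! ### Trajectories, costs and their perturbation -/

section Trajectories

variable {n m : ℕ} {F G : Vec n → Vec m → Vec n} {X Y : Set (Vec n)} {U : Set (Vec m)}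

/-- The control sequence that follows `u` for `j` steps and `v` afterwards. -/
def concat {m : ℕ} (j : ℕ) (u v : ℕ → Vec m) : ℕ → Vec m :=
  fun i => if i < j then u i else v (i - j)

theorem concat_of_lt {j i : ℕ} (u v : ℕ → Vec m) (h : i < j) : concat j u v i = u i := if_pos h

theorem concat_add (j i : ℕ) (u v : ℕ → Vec m) : concat j u v (j + i) = v i := by
  simp [concat]

theorem traj_concat_of_le {j : ℕ} (u v : ℕ → Vec m) (x : Vec n) :
    ∀ k ≤ j, traj F (concat j u v) x k = traj F u x k
  | 0, _ => rfl
  | k + 1, h => by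
    simp only [traj]
    rw [traj_concat_of_le u v x k (by omega), concat_of_lt u v (by omega)]

theorem traj_concat_add (j : ℕ) (u v : ℕ → Vec m) (x : Vec n) :
    ∀ k, traj F (concat j u v) x (j + k) = traj F v (traj F u x j) k
  | 0 => traj_concat_of_le u v x j le_rfl
  | k + 1 => by
    rw [← add_assoc]
    simp only [traj]
    rw [traj_concat_add j u v x k, concat_add]

theorem traj_tail (u : ℕ → Vec m) (x : Vec n) :
    ∀ k, traj F (fun i => u (i + 1)) (F x (u 0)) k = traj F u x (k + 1)
  | 0 => rfl
  | k + 1 => by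
    simp only [traj]
    rw [traj_tail u x k]
    rfl

theorem cost_concat (Q : Matrix (Fin n) (Fin n) ℝ) (R : Matrix (Fin m) (Fin m) ℝ) (j k : ℕ)
    (u v : ℕ → Vec m) (x : Vec n) :
    cost F Q R (j + k) x (concat j u v) = cost F Q R j x u + cost F Q R k (traj F u x j) v := by
  unfold cost
  rw [Finset.sum_range_add]
  congr 1
  · refine Finset.sum_congr rfl fun i hi => ?_
    have hi := Finset.mem_range.1 hi
    rw [traj_concat_of_le u v x i hi.le, concat_of_lt u v hi]
  · exact Finset.sum_congr rfl fun i _ => by rw [traj_concat_add, concat_add]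

theorem cost_succ (Q : Matrix (Fin n) (Fin n) ℝ) (R : Matrix (Fin m) (Fin m) ℝ) (k : ℕ)
    (u : ℕ → Vec m) (x : Vec n) :
    cost F Q R (k + 1) x u = cost F Q R k x u + stageCost Q R (traj F u x k) (u k) :=
  Finset.sum_range_succ _ _

theorem cost_succ' (Q : Matrix (Fin n) (Fin n) ℝ) (R : Matrix (Fin m) (Fin m) ℝ) (k : ℕ)
    (u : ℕ → Vec m) (x : Vec n) :
    cost F Q R (k + 1) x u =
      cost F Q R k (F x (u 0)) (fun i => u (i + 1)) + stageCost Q R x (u 0) := by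
  unfold cost
  rw [Finset.sum_range_succ']
  congr 1
  exact Finset.sum_congr rfl fun i _ => by rw [traj_tail]

theorem Admissible.mono {N k : ℕ} {x : Vec n} {u : ℕ → Vec m} (h : Admissible F Y U N x u)
    (hk : k ≤ N) : Admissible F Y U k x u :=
  ⟨fun i hi => h.1 i (hi.trans_le hk), fun i hi => h.2 i (by
    rw [Finset.mem_Icc] at hi ⊢; omega)⟩

theorem Admissible.tail {N : ℕ} {x : Vec n} {u : ℕ → Vec m} (h : Admissible F Y U (N + 1) x u) :
    Admissible F Y U N (F x (u 0)) fun i => u (i + 1) :=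
  ⟨fun i hi => h.1 _ (by omega), fun i hi => by
    rw [traj_tail]
    exact h.2 _ (by rw [Finset.mem_Icc] at hi ⊢; omega)⟩

theorem Admissible.concat {j k : ℕ} {x : Vec n} {u v : ℕ → Vec m} (hu : Admissible F Y U j x u)
    (hv : Admissible F Y U k (traj F u x j) v) : Admissible F Y U (j + k) x (concat j u v) := by
  constructor
  · intro i hi
    rcases lt_or_ge i j with h | h
    · rw [concat_of_lt u v h]; exact hu.1 i h
    · obtain ⟨l, rfl⟩ := Nat.exists_eq_add_of_le h
      rw [concat_add]; exact hv.1 l (by omega)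
  · intro i hi
    rw [Finset.mem_Icc] at hi
    rcases le_or_gt i j with h | h
    · rw [traj_concat_of_le u v x i h]; exact hu.2 i (Finset.mem_Icc.2 ⟨hi.1, h⟩)
    · obtain ⟨l, rfl⟩ := Nat.exists_eq_add_of_le h.le
      rw [traj_concat_add]; exact hv.2 l (Finset.mem_Icc.2 (by omega))

theorem Admissible.traj_mem {N : ℕ} {x : Vec n} {u : ℕ → Vec m} (h : Admissible F Y U N x u)
    (hYX : Y ⊆ X) (hx : x ∈ X) : ∀ k ≤ N, traj F u x k ∈ X
  | 0, _ => hx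
  | k + 1, hk => hYX (h.2 _ (Finset.mem_Icc.2 ⟨by omega, hk⟩))

theorem gronwall_step {L d e e₀ : ℝ} {k : ℕ} (hL : 0 ≤ L) (hd : 0 ≤ d) (he₀ : 0 ≤ e₀)
    (he : e ≤ (L + 1) ^ k * (e₀ + d)) : L * e + d ≤ (L + 1) ^ (k + 1) * (e₀ + d) := by
  have h1 : 1 ≤ (L + 1) ^ k := one_le_pow₀ (by linarith)
  have h2 := mul_le_mul_of_nonneg_left he hL
  have h3 : e₀ + d ≤ (L + 1) ^ k * (e₀ + d) := le_mul_of_one_le_left (by linarith) h1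
  rw [pow_succ]
  nlinarith

/-- A discrete Gronwall estimate with one-step mismatch `d`. Using `L + 1 ≥ 1` in place of `L`
absorbs the geometric sum into a single power. -/
theorem norm_traj_sub_traj_le {L d : ℝ} (hL : 0 ≤ L) (hd : 0 ≤ d)
    (hFG : ∀ x ∈ X, ∀ y ∈ X, ∀ u ∈ U, ‖F x u - G y u‖ ≤ L * ‖x - y‖ + d) {N : ℕ}
    {u : ℕ → Vec m} (hu : ∀ k < N, u k ∈ U) {x y : Vec n} (hx : ∀ k < N, traj F u x k ∈ X)
    (hy : ∀ k < N, traj G u y k ∈ X) :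
    ∀ k ≤ N, ‖traj F u x k - traj G u y k‖ ≤ (L + 1) ^ k * (‖x - y‖ + d)
  | 0, _ => by simpa [traj] using hd
  | k + 1, hk =>
    (hFG _ (hx k hk) _ (hy k hk) _ (hu k hk)).trans
      (gronwall_step hL hd (norm_nonneg _)
        (norm_traj_sub_traj_le hL hd hFG hu hx hy k (by omega)))

/-- A control sequence whose trajectory keeps the margin `η` stays admissible for nearby
initial values. -/
theorem traj_mem_tighten_of_margin {L ε η : ℝ} (hL : 0 ≤ L) (hε : 0 < ε)
    (hF : ∀ x ∈ X, ∀ y ∈ X, ∀ u ∈ U, ‖F x u - F y u‖ ≤ L * ‖x - y‖) (hη : 0 < η) {N : ℕ}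
    {u : ℕ → Vec m} (hu : ∀ k < N, u k ∈ U) {x y : Vec n}
    (hy : ∀ k ≤ N, traj F u y k ∈ tighten X (ε + η)) (hxy : (L + 1) ^ N * ‖x - y‖ < η) :
    ∀ k ≤ N, traj F u x k ∈ tighten X ε := by
  intro k
  -- The Lipschitz bound holds on `X` only, so step `k` needs all earlier states of the perturbed
  -- trajectory to be in `X`.
  induction k using Nat.strong_induction_on with
  | _ k ih =>
    intro hk
    have h := norm_traj_sub_traj_le (F := F) (G := F) (d := 0) hL le_rfl
      (fun x hx y hy u hu => by simpa using hF x hx y hy u hu) (N := k)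
      (fun i hi => hu i (by omega)) (x := x) (y := y)
      (fun i hi => tighten_subset hε (ih i hi (by omega)))
      (fun i hi => tighten_subset (by linarith) (hy i (by omega))) k le_rfl
    refine mem_tighten_of_dist_lt (hy k hk) (h.trans_lt (lt_of_le_of_lt ?_ hxy))
    rw [add_zero]
    gcongr
    linarith

theorem abs_cost_sub_cost_le {Q : Matrix (Fin n) (Fin n) ℝ} {R : Matrix (Fin m) (Fin m) ℝ}
    {L δ : ℝ} (hL : 0 ≤ L)
    (hℓ : ∀ x ∈ X, ∀ y ∈ X, ∀ u, |stageCost Q R x u - stageCost Q R y u| ≤ L * ‖x - y‖)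
    {N : ℕ} {u : ℕ → Vec m} {x y : Vec n} (hx : ∀ k < N, traj F u x k ∈ X)
    (hy : ∀ k < N, traj G u y k ∈ X)
    (h : ∀ k < N, ‖traj F u x k - traj G u y k‖ ≤ δ) :
    |cost F Q R N x u - cost G Q R N y u| ≤ N * (L * δ) := by
  unfold cost
  rw [← Finset.sum_sub_distrib]
  refine (Finset.abs_sum_le_sum_abs _ _).trans ?_
  refine (Finset.sum_le_card_nsmul _ _ (L * δ) fun k hk => ?_).trans (by simp)
  have hk := Finset.mem_range.1 hk
  exact (hℓ _ (hx k hk) _ (hy k hk) _).trans (mul_le_mul_of_nonneg_left (h k hk) hL)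

end Trajectories

/-! ### The suboptimality index and the relaxed Lyapunov inequality -/

section Suboptimality

/-- Each hypothesis rearranges to `B i * (T (i - 1) + D) ≤ (B i - 1) * (T i + D)`; these
inequalities multiply up from `T 1 = 0`. -/
theorem prod_mul_le_of_growth {B T : ℕ → ℝ} {D : ℝ} {N : ℕ} (hB : ∀ i ∈ Finset.Icc 2 N, 1 ≤ B i)
    (hT : T 1 = 0)
    (h : ∀ i ∈ Finset.Icc 2 N, D ≤ (B i - 1) * T i - B i * T (i - 1)) (hN : 1 ≤ N) :
    (∏ i ∈ Finset.Icc 2 N, B i) * D ≤ (∏ i ∈ Finset.Icc 2 N, (B i - 1)) * (T N + D) := by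
  induction N, hN using Nat.le_induction with
  | base => simp [hT]
  | succ N hN ih =>
    have hmem : N + 1 ∈ Finset.Icc 2 (N + 1) := by simp; omega
    have hsub : ∀ i ∈ Finset.Icc 2 N, i ∈ Finset.Icc 2 (N + 1) := fun i hi => by
      rw [Finset.mem_Icc] at hi ⊢; omega
    have ih := ih (fun i hi => hB i (hsub i hi)) fun i hi => h i (hsub i hi)
    rw [Finset.prod_Icc_succ_top (by omega), Finset.prod_Icc_succ_top (by omega)]
    have h1 := hB _ hmem
    have h2 := h _ hmem
    rw [Nat.add_sub_cancel] at h2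
    have h3 : 0 ≤ ∏ i ∈ Finset.Icc 2 N, (B i - 1) :=
      Finset.prod_nonneg fun i hi => by linarith [hB i (hsub i hi)]
    have h4 := mul_le_mul_of_nonneg_left ih (by linarith : 0 ≤ B (N + 1))
    have h5 : B (N + 1) * (T N + D) ≤ (B (N + 1) - 1) * (T (N + 1) + D) := by linarith
    have h6 := mul_le_mul_of_nonneg_left h5 h3
    linarith

/-- Makes the denominator in `subopt` positive. -/
theorem prod_sub_one_lt_prod {B : ℕ → ℝ} {N : ℕ} (hB : ∀ i ∈ Finset.Icc 2 N, 1 ≤ B i)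
    (hN : 2 ≤ N) : ∏ i ∈ Finset.Icc 2 N, (B i - 1) < ∏ i ∈ Finset.Icc 2 N, B i := by
  have hle : ∏ i ∈ Finset.Icc 3 N, (B i - 1) ≤ ∏ i ∈ Finset.Icc 3 N, B i :=
    Finset.prod_le_prod (fun i hi => by
      have := hB i (by rw [Finset.mem_Icc] at hi ⊢; omega); linarith) fun i _ => by linarith
  have hpos : 0 < ∏ i ∈ Finset.Icc 3 N, B i := Finset.prod_pos fun i hi => by
    have := hB i (by rw [Finset.mem_Icc] at hi ⊢; omega); linarith
  have h2 := hB 2 (by simp [hN])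
  have hI : Finset.Icc 2 N = insert 2 (Finset.Icc 3 N) := by ext; simp; omega
  rw [hI, Finset.prod_insert (by simp), Finset.prod_insert (by simp)]
  nlinarith

theorem one_sub_subopt {B : ℕ → ℝ} {N : ℕ} (hN : 2 ≤ N) :
    1 - subopt B N = (B N - 1) * ((∏ i ∈ Finset.Icc 2 N, (B i - 1)) /
      (∏ i ∈ Finset.Icc 2 N, B i - ∏ i ∈ Finset.Icc 2 N, (B i - 1))) := by
  have hI : Finset.Icc 2 N = insert 2 (Finset.Icc 3 N) := by ext; simp; omega
  have : (B 2 - 1) * ∏ i ∈ Finset.Icc 3 N, (B i - 1) = ∏ i ∈ Finset.Icc 2 N, (B i - 1) := by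
    rw [hI, Finset.prod_insert (by simp)]
  rw [subopt, ← this]
  ring

variable {n m : ℕ} {F : Vec n → Vec m → Vec n} {Y : Set (Vec n)} {U : Set (Vec m)}
  {Q : Matrix (Fin n) (Fin n) ℝ} {R : Matrix (Fin m) (Fin m) ℝ}

/-- The relaxed Lyapunov inequality for the optimal value function, with growth bounds that hold
up to an additive error `e`. -/
theorem IsOptimal.cost_successor_le {N : ℕ} (hN : 2 ≤ N) {B : ℕ → ℝ}
    (hB : ∀ i ∈ Finset.Icc 2 N, 1 ≤ B i) {e : ℝ} {x : Vec n} {u w : ℕ → Vec m}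
    (hu : IsOptimal F Q R Y U N x u) (hw : IsOptimal F Q R Y U N (F x (u 0)) w)
    (hcc : ∀ k < N, ∃ v, Admissible F Y U N (traj F u x k) v ∧ ∀ i ∈ Finset.Icc 1 N,
      cost F Q R i (traj F u x k) v ≤ B i * stageCost Q R (traj F u x k) (u k) + e) :
    cost F Q R N (F x (u 0)) w ≤ cost F Q R N x u - subopt B N * stageCost Q R x (u 0) +
      (1 + (∏ i ∈ Finset.Icc 2 N, (B i - 1)) /
        (∏ i ∈ Finset.Icc 2 N, B i - ∏ i ∈ Finset.Icc 2 N, (B i - 1))) * e := by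
  set P := ∏ i ∈ Finset.Icc 2 N, B i
  set P' := ∏ i ∈ Finset.Icc 2 N, (B i - 1)
  have hP : 0 < P - P' := sub_pos.2 (prod_sub_one_lt_prod hB hN)
  have hP' : 0 ≤ P' := Finset.prod_nonneg fun i hi => by linarith [hB i hi]
  set J := cost F Q R N x u
  set l₀ := stageCost Q R x (u 0)
  set V := cost F Q R N (F x (u 0)) w
  have h0 : J ≤ B N * l₀ + e := by
    obtain ⟨v, hv, hvB⟩ := hcc 0 (by omega)
    exact (hu.2 v hv).trans (hvB N (by simp; omega))
  -- Here `T i` is the cost of the last `i - 1` stages of `u`. With `j = N - i`, the competitor for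
  -- `V` follows the tail of `u` for `j` steps and then the growth-bound control for `i` steps. As
  -- `T i - T (i - 1)` is the stage cost at time `j + 1`, this gives the hypothesis for `i`; `D`
  -- contains `-e` to cancel the error.
  have hchain : P * (V - (J - l₀) - e) ≤ P' * ((J - l₀) + (V - (J - l₀) - e)) := by
    have key := prod_mul_le_of_growth (B := B)
      (T := fun i => J - cost F Q R (N + 1 - i) x u) (D := V - (J - l₀) - e) (N := N) hB
      (by simp [J]) (fun i hi => by
        rw [Finset.mem_Icc] at hi
        obtain ⟨j, rfl⟩ := Nat.exists_eq_add_of_le hi.2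
        have e1 : i + j + 1 - i = j + 1 := by omega
        have e2 : i + j + 1 - (i - 1) = j + 1 + 1 := by omega
        simp only [e1, e2]
        obtain ⟨v, hv, hvB⟩ := hcc (j + 1) (by omega)
        have hadm : Admissible F Y U (j + i) (F x (u 0)) (concat j (fun i => u (i + 1)) v) := by
          refine Admissible.concat (hu.1.mono (by omega : j + 1 ≤ i + j)).tail ?_
          rw [traj_tail]
          exact hv.mono (by omega)
        have h1 := hw.2 _ (by rwa [add_comm i j])
        have h2 := hvB i (by simp; omega)
        rw [add_comm i j, cost_concat, traj_tail, ← add_comm i j] at h1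
        have h3 := cost_succ' (F := F) Q R j u x
        have h4 := cost_succ (F := F) Q R (j + 1) u x
        have h5 : V ≤ cost F Q R j (F x (u 0)) (fun i => u (i + 1)) +
          cost F Q R i (traj F u x (j + 1)) v := h1
        rw [h4]
        change _ = _ + l₀ at h3
        linarith) (by omega)
    have e3 : N + 1 - N = 1 := by omega
    simpa [e3, cost, traj] using key
  -- Solve for `D`; inserting `J - l₀ ≤ (B N - 1) * l₀ + e` then produces the factor `1 - subopt B
  -- N`.
  have h1 : V - (J - l₀) - e ≤ P' / (P - P') * (J - l₀) := by
    rw [div_mul_eq_mul_div, le_div_iff₀ hP]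
    linarith
  have h2 := mul_le_mul_of_nonneg_left (by linarith : J - l₀ ≤ (B N - 1) * l₀ + e)
    (div_nonneg hP' hP.le)
  have h3 := one_sub_subopt (B := B) hN
  change _ = (B N - 1) * (P' / (P - P')) at h3
  have h4 : (1 - subopt B N) * l₀ = (B N - 1) * (P' / (P - P')) * l₀ := by rw [h3]
  linarith

end Suboptimality

/-! ### Bounds for the quadratic stage cost -/

section QuadraticForms

variable {n m : ℕ}

theorem dotProduct_mulVec_eq_inner (A : Matrix (Fin n) (Fin n) ℝ) (x y : Vec n) :
    dotProduct x.ofLp (A.mulVec y.ofLp) = inner ℝ x (Matrix.toEuclideanCLM (𝕜 := ℝ) A y) :=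
  (Matrix.inner_toEuclideanCLM A x y).symm

theorem abs_dotProduct_mulVec_le (A : Matrix (Fin n) (Fin n) ℝ) (x y : Vec n) :
    |dotProduct x.ofLp (A.mulVec y.ofLp)| ≤
      ‖Matrix.toEuclideanCLM (𝕜 := ℝ) A‖ * ‖x‖ * ‖y‖ := by
  rw [dotProduct_mulVec_eq_inner]
  refine (abs_real_inner_le_norm _ _).trans ?_
  nlinarith [mul_le_mul_of_nonneg_left
    ((Matrix.toEuclideanCLM (𝕜 := ℝ) A).le_opNorm y) (norm_nonneg x)]

/-- The minimum over the compact unit sphere serves as `q`, by homogeneity. The sphere is empty only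
in dimension zero. -/
theorem exists_pos_mul_norm_sq_le {A : Matrix (Fin n) (Fin n) ℝ} (hA : A.PosDef) :
    ∃ q > 0, ∀ x : Vec n, q * ‖x‖ ^ 2 ≤ dotProduct x.ofLp (A.mulVec x.ofLp) := by
  have hpos : ∀ x : Vec n, x ≠ 0 → 0 < dotProduct x.ofLp (A.mulVec x.ofLp) := fun x hx => by
    simpa using hA.dotProduct_mulVec_pos (x := x.ofLp) (by simpa using hx)
  rcases (Metric.sphere (0 : Vec n) 1).eq_empty_or_nonempty with he | hne
  · refine ⟨1, one_pos, fun x => ?_⟩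
    rcases eq_or_ne x 0 with rfl | hx
    · simp
    · have : (‖x‖⁻¹ • x) ∈ Metric.sphere (0 : Vec n) 1 := by
        simp [norm_smul, hx]
      simp [he] at this
  · have hc : Continuous fun x : Vec n => dotProduct x.ofLp (A.mulVec x.ofLp) := by
      simp only [dotProduct_mulVec_eq_inner]
      fun_prop
    obtain ⟨z, hz, hmin⟩ := (isCompact_sphere (0 : Vec n) 1).exists_isMinOn hne hc.continuousOn
    refine ⟨_, hpos z (by rintro rfl; simp at hz), fun x => ?_⟩
    rcases eq_or_ne x 0 with rfl | hx
    · simp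
    · have hx' : 0 < ‖x‖ := norm_pos_iff.2 hx
      have h := isMinOn_iff.1 hmin (‖x‖⁻¹ • x) (by simp [norm_smul, hx])
      simp only [WithLp.ofLp_smul, Matrix.mulVec_smul, smul_dotProduct, dotProduct_smul,
        smul_eq_mul] at h
      rw [← mul_assoc, ← mul_inv, ← div_eq_inv_mul, le_div_iff₀ (by positivity)] at h
      rwa [pow_two]

variable {Q : Matrix (Fin n) (Fin n) ℝ} {R : Matrix (Fin m) (Fin m) ℝ} {X : Set (Vec n)}
  {U : Set (Vec m)}

/-- The control terms cancel, so the constant is uniform in `u`. -/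
theorem exists_lipschitz_stageCost (Q : Matrix (Fin n) (Fin n) ℝ) (R : Matrix (Fin m) (Fin m) ℝ)
    (hX : Bornology.IsBounded X) :
    ∃ L ≥ 0, ∀ x ∈ X, ∀ y ∈ X, ∀ u, |stageCost Q R x u - stageCost Q R y u| ≤ L * ‖x - y‖ := by
  obtain ⟨c, hc, hcX⟩ := hX.exists_pos_norm_le
  refine ⟨‖Matrix.toEuclideanCLM (𝕜 := ℝ) Q‖ * c + ‖Matrix.toEuclideanCLM (𝕜 := ℝ) Q‖ * c,
    by positivity, fun x hx y hy u => ?_⟩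
  have h : stageCost Q R x u - stageCost Q R y u =
      dotProduct x.ofLp (Q.mulVec (x - y).ofLp) + dotProduct (x - y).ofLp (Q.mulVec y.ofLp) := by
    simp only [stageCost, WithLp.ofLp_sub, Matrix.mulVec_sub, dotProduct_sub, sub_dotProduct]
    ring
  rw [h, add_mul]
  refine (abs_add_le _ _).trans (add_le_add ?_ ?_)
  · refine (abs_dotProduct_mulVec_le Q _ _).trans ?_
    gcongr
    exact hcX x hx
  · refine (abs_dotProduct_mulVec_le Q _ _).trans ?_
    rw [mul_right_comm]
    gcongr
    exact hcX y hy

theorem mul_norm_sq_le_stageCost {q : ℝ}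
    (hq : ∀ x : Vec n, q * ‖x‖ ^ 2 ≤ dotProduct x.ofLp (Q.mulVec x.ofLp)) (hR : R.PosSemidef)
    (x : Vec n) (u : Vec m) : q * ‖x‖ ^ 2 ≤ stageCost Q R x u := by
  have : 0 ≤ dotProduct u.ofLp (R.mulVec u.ofLp) := by
    simpa using hR.dotProduct_mulVec_nonneg u.ofLp
  rw [stageCost]
  linarith [hq x]

theorem minStageCost_le (h : ∀ x u, 0 ≤ stageCost Q R x u) (x : Vec n) {u : Vec m} (hu : u ∈ U) :
    minStageCost Q R U x ≤ stageCost Q R x u :=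
  ciInf_le (f := fun u : U => stageCost Q R x u) ⟨0, by rintro _ ⟨v, rfl⟩; exact h _ _⟩ ⟨u, hu⟩

theorem minStageCost_le_norm_sq (h : ∀ x u, 0 ≤ stageCost Q R x u) (x : Vec n)
    (hU : (0 : Vec m) ∈ U) :
    minStageCost Q R U x ≤ ‖Matrix.toEuclideanCLM (𝕜 := ℝ) Q‖ * ‖x‖ ^ 2 := by
  refine (minStageCost_le h x hU).trans ?_
  have := (le_abs_self _).trans (abs_dotProduct_mulVec_le Q x x)
  simp only [stageCost, WithLp.ofLp_zero, zero_dotProduct, add_zero]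
  linarith

end QuadraticForms

/-! ### From practical Lyapunov functions to practical stability -/

section Stability

theorem isClassKL_exp {b κ : ℝ} (hb : 0 < b) (hκ : 0 < κ) :
    IsClassKL fun s t => b * s * Real.exp (-(κ * t)) where
  continuousOn := by fun_prop
  zero t _ := by simp
  strictMonoOn t _ s _ s' _ h := by
    have := Real.exp_pos (-(κ * t))
    dsimp only
    gcongr
  strictAntiOn s hs t _ t' _ h := by
    dsimp only
    gcongr
  tendsto s _ := by
    have h : Filter.Tendsto (fun t => κ * t) Filter.atTop Filter.atTop :=
      Filter.tendsto_id.const_mul_atTop hκ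
    simpa using (Real.tendsto_exp_neg_atTop_nhds_zero.comp h).const_mul (b * s)

/-- A family of practical Lyapunov functions with quadratic bounds yields semi-global practical
asymptotic stability. -/
theorem semigloballyPracticallyAsymptoticallyStable_of_lyapunov {n : ℕ}
    {step : ℝ → Vec n → Vec n} {S : Set (Vec n)} {V : ℝ → Vec n → ℝ} {q C a c ε₁ : ℝ}
    (hq : 0 < q) (hC : 0 ≤ C) (ha : 0 < a) (hc : 0 ≤ c) (hε₁ : 0 < ε₁)
    (hS : ∀ ε ∈ Set.Ioc 0 ε₁, ∀ x ∈ S, step ε x ∈ S)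
    (hlow : ∀ ε ∈ Set.Ioc 0 ε₁, ∀ x ∈ S, q * ‖x‖ ^ 2 ≤ V ε x)
    (hup : ∀ ε ∈ Set.Ioc 0 ε₁, ∀ x ∈ S, V ε x ≤ C * ‖x‖ ^ 2 + c * ε)
    (hdec : ∀ ε ∈ Set.Ioc 0 ε₁, ∀ x ∈ S, V ε (step ε x) ≤ V ε x - a * ‖x‖ ^ 2 + c * ε) :
    SemigloballyPracticallyAsymptoticallyStable step S := by
  -- Enlarging `C` ensures `0 < θ < 1`, even if `C = 0`.
  obtain ⟨C', hC'⟩ : ∃ C' : ℝ, C' = C + 2 * a := ⟨_, rfl⟩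
  have hC'0 : 0 < C' := by linarith
  set θ := a / C' with hθ
  have hθ0 : 0 < θ := by positivity
  have hθ1 : θ < 1 := by rw [hθ, div_lt_one hC'0]; linarith
  have haθ : a = θ * C' := by rw [hθ]; field_simp
  -- `V` contracts by `1 - θ` per step and is quadratic in the norm, hence half the rate.
  set κ := -Real.log (1 - θ) / 2 with hκdef
  have hκ : 0 < κ := by
    have := Real.log_neg (by linarith : 0 < 1 - θ) (by linarith)
    rw [hκdef]; linarith
  have hexp : ∀ k : ℕ, Real.exp (-(κ * k)) ^ 2 = (1 - θ) ^ k := fun k => by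
    rw [← Real.exp_nat_mul]
    conv_rhs => rw [← Real.exp_log (by linarith : 0 < 1 - θ)]
    rw [← Real.exp_nat_mul (Real.log _), hκdef]
    congr 1
    push_cast
    ring
  -- The factor `2` gives the decaying term one half of `q * M ^ 2` in the final estimate; `ε₁`
  -- below is chosen so that the `ε`-terms fit in the other half.
  set b := Real.sqrt (2 * C' / q) with hb
  have hb2 : b ^ 2 = 2 * C' / q := Real.sq_sqrt (by positivity)
  refine ⟨_, isClassKL_exp (b := b) (by positivity) hκ, fun r hr R hR => ?_⟩
  set K := c * (1 + 2 / θ) with hK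
  have hK0 : 0 ≤ K := by positivity
  refine ⟨min ε₁ (q * r ^ 2 / (2 * (K + 1))), by positivity, fun x hx _ ε hε k => ?_⟩
  have hε' : ε ∈ Set.Ioc 0 ε₁ := ⟨hε.1, hε.2.trans (min_le_left _ _)⟩
  have hKε : K * ε ≤ q * r ^ 2 / 2 := by
    have h1 := hε.2.trans (min_le_right _ _)
    rw [le_div_iff₀ (by positivity)] at h1
    nlinarith [hε.1]
  have hmem : ∀ k : ℕ, (step ε)^[k] x ∈ S := fun k => by
    induction k with
    | zero => exact hx
    | succ k ih => rw [Function.iterate_succ_apply']; exact hS ε hε' _ ih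
  -- The one-step bound is `(1 - θ) * V + 2 * c * ε`, whose fixed point is the additive term.
  have hV : ∀ k : ℕ, V ε ((step ε)^[k] x) ≤ (1 - θ) ^ k * V ε x + 2 * (c * ε) / θ := fun k => by
    induction k with
    | zero =>
      have : 0 ≤ 2 * (c * ε) / θ := by have := hε.1.le; positivity
      simpa using this
    | succ k ih =>
      rw [Function.iterate_succ_apply', pow_succ]
      set z := (step ε)^[k] x
      have h1 := hdec ε hε' z (hmem k)
      have h2 := hup ε hε' z (hmem k)
      have h3 : V ε z ≤ C' * ‖z‖ ^ 2 + c * ε := by nlinarith [sq_nonneg ‖z‖]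
      have h4 := mul_le_mul_of_nonneg_left h3 hθ0.le
      have h5 : a * ‖z‖ ^ 2 = θ * (C' * ‖z‖ ^ 2) := by rw [← mul_assoc, ← haθ]
      have h6 := mul_le_mul_of_nonneg_left ih (by linarith : 0 ≤ 1 - θ)
      have h7 : θ * (2 * (c * ε) / θ) = 2 * (c * ε) := by field_simp
      have h8 : θ * (c * ε) ≤ 1 * (c * ε) :=
        mul_le_mul_of_nonneg_right hθ1.le (mul_nonneg hc hε.1.le)
      linarith
  refine ⟨hmem k, ?_⟩
  have h1 := hlow ε hε' _ (hmem k)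
  have h2 := hV k
  have h3 := hup ε hε' x hx
  have hθk0 : 0 ≤ (1 - θ) ^ k := pow_nonneg (by linarith) k
  have hθk1 : (1 - θ) ^ k ≤ 1 := pow_le_one₀ (by linarith) (by linarith)
  have h4 : V ε x ≤ C' * ‖x‖ ^ 2 + c * ε := by nlinarith [sq_nonneg ‖x‖]
  have h5 := mul_le_mul_of_nonneg_left h4 hθk0
  have h6 : (1 - θ) ^ k * (c * ε) ≤ 1 * (c * ε) :=
    mul_le_mul_of_nonneg_right hθk1 (mul_nonneg hc hε.1.le)
  have h7 : K * ε = c * ε + 2 * (c * ε) / θ := by rw [hK]; ring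
  have h8 : q * (b * ‖x‖ * Real.exp (-(κ * k))) ^ 2 = 2 * ((1 - θ) ^ k * (C' * ‖x‖ ^ 2)) := by
    rw [mul_pow, mul_pow, hexp, hb2]
    field_simp
  set M := max (b * ‖x‖ * Real.exp (-(κ * k))) r
  have hM1 : (b * ‖x‖ * Real.exp (-(κ * k))) ^ 2 ≤ M ^ 2 :=
    pow_le_pow_left₀ (by positivity) (le_max_left _ _) 2
  have hM2 : r ^ 2 ≤ M ^ 2 := pow_le_pow_left₀ hr.le (le_max_right _ _) 2
  refine le_of_sq_le_sq ?_ (hr.le.trans (le_max_right _ _))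
  refine le_of_mul_le_mul_left ?_ hq
  have h9 := mul_le_mul_of_nonneg_left hM1 hq.le
  have h10 := mul_le_mul_of_nonneg_left hM2 hq.le
  linarith

/-- Dimension zero is separate because `1 ≤ B 1` is derived below from a nonzero state. -/
theorem semigloballyPracticallyAsymptoticallyStable_of_subsingleton {n : ℕ}
    [Subsingleton (Vec n)] (step : ℝ → Vec n → Vec n) (S : Set (Vec n)) :
    SemigloballyPracticallyAsymptoticallyStable step S := by
  refine ⟨_, isClassKL_exp one_pos one_pos, fun r hr R _ => ⟨1, one_pos, fun x hx _ ε _ k => ?_⟩⟩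
  rw [Subsingleton.elim ((step ε)^[k] x) x]
  refine ⟨hx, ?_⟩
  rw [Subsingleton.elim x 0, norm_zero]
  exact hr.le.trans (le_max_right _ _)

end Stability

/-! ### MPC with uniformly Lipschitz approximate dynamics -/

section Approximation

variable {n m : ℕ} {f : Vec n → Vec m → Vec n} {X S : Set (Vec n)} {U : Set (Vec m)}
  {Q : Matrix (Fin n) (Fin n) ℝ} {R : Matrix (Fin m) (Fin m) ℝ}

/-- Practical asymptotic stability of MPC based on approximations `F ε` of `f` that are uniformly
Lipschitz on `X` and `O(ε)`-close to `f` there. -/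
theorem semigloballyPracticallyAsymptoticallyStable_of_approximation [Nontrivial (Vec n)]
    {F : ℝ → Vec n → Vec m → Vec n} (hX : Bornology.IsBounded X) (hU0 : (0 : Vec m) ∈ U)
    {ε₀ L c : ℝ} (hε₀ : 0 < ε₀) (hL : 0 ≤ L) (hc : 0 ≤ c)
    (hfF : ∀ ε ∈ Set.Ioc 0 ε₀, ∀ x ∈ X, ∀ u ∈ U, ‖f x u - F ε x u‖ ≤ c * ε)
    (hF : ∀ ε ∈ Set.Ioc 0 ε₀, ∀ x ∈ X, ∀ y ∈ X, ∀ u ∈ U, ‖F ε x u - F ε y u‖ ≤ L * ‖x - y‖)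
    (hQ : Q.PosDef) (hR : R.PosDef) {N : ℕ} (hN : 2 ≤ N)
    {B : ℕ → ℝ} (hBmono : MonotoneOn B (Set.Ici 1)) (hα : 0 < subopt B N)
    (hSX : S ⊆ X) (hS0 : (0 : Vec n) ∈ interior S) {η : ℝ} (hη : 0 < η)
    (hmargin : ∀ ε ∈ Set.Ioc 0 ε₀, ∀ x ∈ S, ∃ u, IsOptimal (F ε) Q R (tighten X ε) U N x u ∧
      ∀ k ≤ N, traj (F ε) u x k ∈ tighten X (ε + η))
    {opt : ℝ → Vec n → ℕ → Vec m}
    (hopt : ∀ ε ∈ Set.Ioc 0 ε₀, ∀ x ∈ S, IsOptimal (F ε) Q R (tighten X ε) U N x (opt ε x))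
    (hforward : ∀ ε ∈ Set.Ioc 0 ε₀, ∀ x ∈ S, F ε x (opt ε x 0) ∈ tighten S η)
    (hcc : ∀ ε ∈ Set.Ioc 0 ε₀, ∀ x ∈ S, ∀ k < N,
      CostControllableAt f (F ε) Q R X (tighten X ε) U N B (traj (F ε) (opt ε x) x k)) :
    SemigloballyPracticallyAsymptoticallyStable (fun ε x => f x (opt ε x 0)) S := by
  obtain ⟨q, hq, hqQ⟩ := exists_pos_mul_norm_sq_le hQ
  have hlow := mul_norm_sq_le_stageCost hqQ hR.posSemidef
  have hℓ0 : ∀ x u, 0 ≤ stageCost Q R x u := fun x u => (by positivity : 0 ≤ q * ‖x‖ ^ 2).trans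
    (hlow x u)
  obtain ⟨Lℓ, hLℓ, hLip⟩ := exists_lipschitz_stageCost Q R hX
  -- At a nonzero state `ℓ⋆ > 0`, and `ℓ⋆` is at most the one-step cost, which is at most `B 1 *
  -- ℓ⋆`.
  have hBone : 1 ≤ B 1 := by
    obtain ⟨x, hx, hx0⟩ : ∃ x ∈ S, x ≠ 0 := by
      have h : ∀ᶠ x in nhdsWithin (0 : Vec n) {0}ᶜ, x ∈ S :=
        nhdsWithin_le_nhds (mem_interior_iff_mem_nhds.1 hS0)
      exact (h.and self_mem_nhdsWithin).exists
    obtain ⟨v, hv, -, hvB⟩ := hcc ε₀ ⟨hε₀, le_rfl⟩ x hx 0 (by omega)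
    have h1 := hvB 1 (by simp; omega)
    simp only [cost, traj, Finset.sum_range_one] at h1
    have h2 := minStageCost_le hℓ0 x (hv.1 0 (by omega))
    have h3 : 0 < minStageCost Q R U x :=
      have : Nonempty U := ⟨⟨0, hU0⟩⟩
      lt_of_lt_of_le (by have := norm_pos_iff.2 hx0; positivity : 0 < q * ‖x‖ ^ 2)
        (le_ciInf fun u => hlow x u)
    exact le_of_mul_le_mul_right (by linarith) h3
  have hB : ∀ i, 1 ≤ i → 1 ≤ B i := fun i hi => hBone.trans (hBmono (by simp) hi hi)
  set Λ := (L + 1) ^ N with hΛ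
  have hΛ1 : 1 ≤ Λ := one_le_pow₀ (by linarith)
  set c₁ := N * (Lℓ * (Λ * c)) with hc₁
  have hc₁0 : 0 ≤ c₁ := by positivity
  set Γ := 1 + (∏ i ∈ Finset.Icc 2 N, (B i - 1)) /
    (∏ i ∈ Finset.Icc 2 N, B i - ∏ i ∈ Finset.Icc 2 N, (B i - 1)) with hΓ
  have hB2 : ∀ i ∈ Finset.Icc 2 N, 1 ≤ B i := fun i hi =>
    hB i (by rw [Finset.mem_Icc] at hi; omega)
  have hΓ1 : 1 ≤ Γ := by
    have h1 := sub_pos.2 (prod_sub_one_lt_prod hB2 hN)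
    have h2 : 0 ≤ ∏ i ∈ Finset.Icc 2 N, (B i - 1) :=
      Finset.prod_nonneg fun i hi => by linarith [hB2 i hi]
    rw [hΓ]
    linarith [div_nonneg h2 h1.le]
  have hpow : ∀ k ≤ N, (L + 1) ^ k ≤ Λ := fun k hk => pow_le_pow_right₀ (by linarith) hk
  -- growth bounds for the approximate dynamics
  have hgrowth : ∀ ε ∈ Set.Ioc 0 ε₀, ∀ x ∈ S, ∀ k < N,
      ∃ v, Admissible (F ε) (tighten X ε) U N (traj (F ε) (opt ε x) x k) v ∧
        ∀ i ∈ Finset.Icc 1 N, cost (F ε) Q R i (traj (F ε) (opt ε x) x k) v ≤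
          B i * minStageCost Q R U (traj (F ε) (opt ε x) x k) + c₁ * ε := by
    intro ε hε x hx k hk
    obtain ⟨v, hvf, hvF, hvB⟩ := hcc ε hε x hx k hk
    refine ⟨v, hvF, fun i hi => ?_⟩
    have hzX : traj (F ε) (opt ε x) x k ∈ X :=
      (hopt ε hε x hx).1.traj_mem (tighten_subset hε.1) (hSX hx) k hk.le
    set z := traj (F ε) (opt ε x) x k
    have hiN := (Finset.mem_Icc.1 hi).2
    have hf := hvf.traj_mem subset_rfl hzX
    have hFm := hvF.traj_mem (tighten_subset hε.1) hzX
    have hcε : 0 ≤ c * ε := mul_nonneg hc hε.1.le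
    have h1 := norm_traj_sub_traj_le (F := F ε) (G := f) hL hcε
      (fun a ha b hb u hu => by
        have h2 := norm_sub_le_norm_sub_add_norm_sub (F ε a u) (F ε b u) (f b u)
        have h3 := hF ε hε a ha b hb u hu
        have h4 := hfF ε hε b hb u hu
        rw [norm_sub_rev] at h4
        linarith) hvf.1 (fun j hj => hFm j hj.le) (fun j hj => hf j hj.le)
    have h2 := abs_cost_sub_cost_le (F := F ε) (G := f) (R := R) (N := i) (δ := Λ * (c * ε)) hLℓ
      hLip (u := v) (x := z) (y := z) (fun j hj => hFm j (by omega)) (fun j hj => hf j (by omega))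
      (fun j hj => (h1 j (by omega)).trans (by
        rw [sub_self, norm_zero, zero_add]
        exact mul_le_mul_of_nonneg_right (hpow j (by omega)) hcε))
    have h3 : (i : ℝ) * (Lℓ * (Λ * (c * ε))) ≤ c₁ * ε := by
      rw [hc₁, show (N : ℝ) * (Lℓ * (Λ * c)) * ε = N * (Lℓ * (Λ * (c * ε))) by ring]
      gcongr
    have h4 := hvB i hi
    linarith [(le_abs_self _).trans h2]
  -- Forces `Λ * (c * ε) < η`: the true successor stays in `S`, and over the horizon its deviation
  -- stays within the margin. `c + 1` covers `c = 0`.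
  set ε₁ := min ε₀ (η / (2 * Λ * (c + 1))) with hε₁
  have hε₁0 : 0 < ε₁ := by positivity
  have hε₁ε₀ : ∀ ε ∈ Set.Ioc 0 ε₁, ε ∈ Set.Ioc 0 ε₀ := fun ε hε =>
    ⟨hε.1, hε.2.trans (min_le_left _ _)⟩
  have hsmall : ∀ ε ∈ Set.Ioc 0 ε₁, Λ * (c * ε) < η := fun ε hε => by
    have h1 := hε.2.trans (min_le_right _ _)
    rw [le_div_iff₀ (by positivity)] at h1
    have h2 : 0 < Λ * ε := mul_pos (by linarith) hε.1
    nlinarith [mul_nonneg hc h2.le]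
  have hdist : ∀ ε ∈ Set.Ioc 0 ε₁, ∀ x ∈ S,
      ‖f x (opt ε x 0) - F ε x (opt ε x 0)‖ ≤ c * ε := fun ε hε x hx =>
    hfF ε (hε₁ε₀ ε hε) x (hSX hx) _ ((hopt ε (hε₁ε₀ ε hε) x hx).1.1 0 (by omega))
  have hinv : ∀ ε ∈ Set.Ioc 0 ε₁, ∀ x ∈ S, f x (opt ε x 0) ∈ S := fun ε hε x hx =>
    mem_of_mem_tighten_of_dist_lt (hforward ε (hε₁ε₀ ε hε) x hx)
      ((hdist ε hε x hx).trans_lt (lt_of_le_of_lt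
        (le_mul_of_one_le_left (mul_nonneg hc hε.1.le) hΛ1) (hsmall ε hε)))
  refine semigloballyPracticallyAsymptoticallyStable_of_lyapunov
    (V := fun ε x => cost (F ε) Q R N x (opt ε x)) (q := q)
    (C := B N * ‖Matrix.toEuclideanCLM (𝕜 := ℝ) Q‖) (a := subopt B N * q)
    (c := Γ * c₁ + c₁) (ε₁ := ε₁) hq
    (mul_nonneg (by linarith [hB N (by omega)]) (norm_nonneg _)) (mul_pos hα hq) (by positivity)
    hε₁0 hinv ?_ ?_ ?_
  · intro ε hε x hx
    refine (hlow x (opt ε x 0)).trans ?_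
    exact Finset.single_le_sum (f := fun k => stageCost Q R (traj (F ε) (opt ε x) x k)
      (opt ε x k)) (fun k _ => hℓ0 _ _) (Finset.mem_range.2 (by omega : 0 < N))
  · intro ε hε x hx
    have hε' := hε₁ε₀ ε hε
    obtain ⟨v, hv, hvB⟩ := hgrowth ε hε' x hx 0 (by omega)
    have h1 := (hopt ε hε' x hx).2 v hv
    have h2 := hvB N (by simp; omega)
    have h3 := mul_le_mul_of_nonneg_left (minStageCost_le_norm_sq (R := R) hℓ0 x hU0)
      (by linarith [hB N (by omega)] : 0 ≤ B N)
    have h4 : 0 ≤ Γ * c₁ * ε := mul_nonneg (by positivity) hε.1.le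
    simp only [traj] at h2
    linarith
  · intro ε hε x hx
    have hε' := hε₁ε₀ ε hε
    have hx' := hinv ε hε x hx
    have hy : F ε x (opt ε x 0) ∈ S := tighten_subset hη (hforward ε hε' x hx)
    have hd := hdist ε hε x hx
    have hux := hopt ε hε' x hx
    set x' := f x (opt ε x 0)
    set y := F ε x (opt ε x 0)
    -- `opt ε y` itself need not keep the margin, so a minimizer `w` at `y` that does is used; it is
    -- a competitor at `x'`, whence `V ε x' ≤ cost w from y + c₁ * ε`.
    obtain ⟨w, hw, hwm⟩ := hmargin ε hε' y hy
    have hΛd : Λ * ‖x' - y‖ ≤ Λ * (c * ε) := mul_le_mul_of_nonneg_left hd (by linarith)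
    have hx'm := traj_mem_tighten_of_margin hL hε.1 (hF ε hε') hη hw.1.1 hwm
      (hΛd.trans_lt (hsmall ε hε))
    have h1 := (hopt ε hε' x' hx').2 w ⟨hw.1.1, fun k hk => hx'm k (Finset.mem_Icc.1 hk).2⟩
    have hxX : ∀ k ≤ N, traj (F ε) w x' k ∈ X := fun k hk => tighten_subset hε.1 (hx'm k hk)
    have hyX : ∀ k ≤ N, traj (F ε) w y k ∈ X := hw.1.traj_mem (tighten_subset hε.1) (hSX hy)
    have h2 := norm_traj_sub_traj_le (F := F ε) (G := F ε) (d := 0) hL le_rfl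
      (fun a ha b hb u hu => by simpa using hF ε hε' a ha b hb u hu) hw.1.1
      (fun k hk => hxX k hk.le) (fun k hk => hyX k hk.le)
    have h3 := abs_cost_sub_cost_le (F := F ε) (G := F ε) (R := R) (N := N) (δ := Λ * (c * ε)) hLℓ
      hLip (fun k hk => hxX k hk.le) (fun k hk => hyX k hk.le)
      (fun k hk => (h2 k hk.le).trans (by
        rw [add_zero]
        exact (mul_le_mul_of_nonneg_right (hpow k hk.le) (norm_nonneg _)).trans hΛd))
    have h4 := hux.cost_successor_le (e := c₁ * ε) hN hB2 hw (fun k hk => by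
      obtain ⟨v, hv, hvB⟩ := hgrowth ε hε' x hx k hk
      refine ⟨v, hv, fun i hi => (hvB i hi).trans ?_⟩
      have h5 := minStageCost_le hℓ0 (traj (F ε) (opt ε x) x k) (hux.1.1 k hk)
      have h6 := hB i (Finset.mem_Icc.1 hi).1
      gcongr)
    have h5 := mul_le_mul_of_nonneg_left (hlow x (opt ε x 0)) hα.le
    have h6 : (N : ℝ) * (Lℓ * (Λ * (c * ε))) = c₁ * ε := by rw [hc₁]; ring
    have h7 := (le_abs_self _).trans h3
    change _ ≤ _ + Γ * (c₁ * ε) at h4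
    linarith

end Approximation

/-! ### Error and Lipschitz bounds for the EDMD surrogate -/

section Surrogate

open Matrix

variable {n m p : ℕ} {sys : ControlAffineSystem n m} {dict : Dictionary n p} {X : Set (Vec n)}
  {U : Set (Vec m)} {Δt : ℝ}

/-- By invariance the coefficients of `ψₖ(f(·, u))` form row `k` of a matrix as required, so the
default value `0` is not taken. -/
theorem Dictionary.koopmanMatrix_mulVec {f : Vec n → Vec m → Vec n}
    (hinv : dict.IsInvariant f X U) {x : Vec n} (hx : x ∈ X) {u : Vec m} (hu : u ∈ U) :
    dict.Ψ (f x u) = (dict.koopmanMatrix f X u).mulVec (dict.Ψ x) := by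
  have h : ∃ K : Matrix (ObsIdx n p) (ObsIdx n p) ℝ,
      ∀ x ∈ X, dict.Ψ (f x u) = K.mulVec (dict.Ψ x) := by
    have h1 : ∀ k, ∃ a : ObsIdx n p → ℝ, ∀ x ∈ X,
        dict.obs k (f x u) = ∑ i, a i * dict.obs i x := fun k => by
      obtain ⟨φ, hφ, h⟩ := hinv u hu (dict.obs k) (Submodule.subset_span ⟨k, rfl⟩)
      obtain ⟨a, rfl⟩ := (Submodule.mem_span_range_iff_exists_fun ℝ).1 hφ
      exact ⟨a, fun x hx => by rw [h x hx]; simp⟩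
    choose a ha using h1
    exact ⟨Matrix.of a, fun x hx => funext fun k => ha k x hx⟩
  rw [Dictionary.koopmanMatrix, dif_pos h]
  exact h.choose_spec x hx

theorem Dictionary.contDiff_obs (dict : Dictionary n p) (k : ObsIdx n p) :
    ContDiff ℝ 1 (dict.obs k) := by
  rcases k with _ | i | k
  · exact contDiff_const
  · change ContDiff ℝ 1 fun x : Vec n => x i
    fun_prop
  · exact dict.contDiff_extra k

theorem Dictionary.contDiff_toLp_Ψ (dict : Dictionary n p) :
    ContDiff ℝ 1 fun x => WithLp.toLp 2 (dict.Ψ x) :=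
  (contDiff_piLp 2).2 dict.contDiff_obs

/-- The projection onto the components belonging to the coordinate observables. -/
def coordProj (v : EuclideanSpace ℝ (ObsIdx n p)) : Vec n :=
  WithLp.toLp 2 fun i => v (Sum.inr (Sum.inl i))

theorem norm_coordProj_le (v : EuclideanSpace ℝ (ObsIdx n p)) : ‖coordProj v‖ ≤ ‖v‖ := by
  rw [EuclideanSpace.norm_eq, EuclideanSpace.norm_eq]
  refine Real.sqrt_le_sqrt ?_
  rw [Fintype.sum_sum_type, Fintype.sum_sum_type]
  have h1 : 0 ≤ ∑ i, ‖v (Sum.inl i)‖ ^ 2 := Finset.sum_nonneg fun _ _ => by positivity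
  have h2 : 0 ≤ ∑ i, ‖v (Sum.inr (Sum.inr i))‖ ^ 2 := Finset.sum_nonneg fun _ _ => by positivity
  simp only [coordProj]
  linarith

theorem norm_coordProj_sub_coordProj_le (v w : EuclideanSpace ℝ (ObsIdx n p)) :
    ‖coordProj v - coordProj w‖ ≤ ‖v - w‖ :=
  norm_coordProj_le (v - w)

theorem EDMDModel.surrogate_eq (E : EDMDModel sys dict X) (x : Vec n) (u : Vec m) :
    E.surrogate Δt x u = coordProj (toEuclideanCLM (𝕜 := ℝ) (E.propagator Δt u)
      (WithLp.toLp 2 (dict.Ψ x))) := rfl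

theorem Dictionary.eq_coordProj_koopmanMatrix {f : Vec n → Vec m → Vec n}
    (hinv : dict.IsInvariant f X U) {x : Vec n} (hx : x ∈ X) {u : Vec m} (hu : u ∈ U) :
    f x u = coordProj (toEuclideanCLM (𝕜 := ℝ) (dict.koopmanMatrix f X u)
      (WithLp.toLp 2 (dict.Ψ x))) := by
  rw [toEuclideanCLM_toLp, ← Dictionary.koopmanMatrix_mulVec hinv hx hu]
  rfl

theorem EDMDModel.norm_surrogate_sub_surrogate_le (E : EDMDModel sys dict X) (x y : Vec n)
    (u : Vec m) : ‖E.surrogate Δt x u - E.surrogate Δt y u‖ ≤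
      ‖toEuclideanCLM (𝕜 := ℝ) (E.propagator Δt u)‖ *
        ‖WithLp.toLp 2 (dict.Ψ x) - WithLp.toLp 2 (dict.Ψ y)‖ := by
  rw [E.surrogate_eq, E.surrogate_eq]
  refine (norm_coordProj_sub_coordProj_le _ _).trans ?_
  rw [← map_sub]
  exact ContinuousLinearMap.le_opNorm _ _

theorem EDMDModel.norm_sampled_sub_surrogate_le (E : EDMDModel sys dict X)
    (hinv : dict.IsInvariant (sys.sampled Δt) X U) {ε : ℝ} (hE : E.OperatorBound Δt U ε)
    {x : Vec n} (hx : x ∈ X) {u : Vec m} (hu : u ∈ U) :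
    ‖sys.sampled Δt x u - E.surrogate Δt x u‖ ≤ ε * ‖WithLp.toLp 2 (dict.Ψ x)‖ := by
  rw [E.surrogate_eq, Dictionary.eq_coordProj_koopmanMatrix hinv hx hu]
  refine (norm_coordProj_sub_coordProj_le _ _).trans ?_
  rw [← _root_.sub_apply, ← map_sub]
  exact ContinuousLinearMap.le_of_opNorm_le _ (hE u hu) _

-- Bounds the propagators of one fixed model over the compact set `U`.
open scoped Matrix.Norms.L2Operator in
theorem EDMDModel.continuous_norm_propagator (E : EDMDModel sys dict X) :
    Continuous fun u => ‖toEuclideanCLM (𝕜 := ℝ) (E.propagator Δt u)‖ := by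
  let : NormedAlgebra ℚ (Matrix (ObsIdx n p) (ObsIdx n p) ℝ) :=
    NormedAlgebra.restrictScalars ℚ ℝ _
  simp only [l2_opNorm_toEuclideanCLM, EDMDModel.propagator, EDMDModel.generator]
  refine continuous_norm.comp (NormedSpace.exp_continuous.comp ?_)
  fun_prop

end Surrogate

end EDMDMPC

/-! ### The main theorem -/

open EDMDMPC in
theorem mainTheorem1 {n m p : ℕ}
    -- true system, constraints, sampling period
    (sys : ControlAffineSystem n m) (X : Set (Vec n)) (U : Set (Vec m))
    (hX : IsCompact X) (hU : IsCompact U)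
    (h0 : ((0, 0) : Vec n × Vec m) ∈ interior (X ×ˢ U))
    (Δt : ℝ) (hΔt : 0 < Δt)
    (hsol : ∀ x ∈ X, ∀ u ∈ U, ∃ γ, sys.IsSolution Δt x u γ)
    -- dictionary and its invariance
    (dict : Dictionary n p)
    (hindep : LinearIndependent ℝ fun k => X.domRestrict (dict.obs k))
    (hinv : dict.IsInvariant (sys.sampled Δt) X U)
    -- EDMD models with the operator error bound
    (ε₀ : ℝ) (hε₀ : 0 < ε₀) (model : ℝ → EDMDModel sys dict X)
    (hbound : ∀ ε ∈ Set.Ioc 0 ε₀, (model ε).OperatorBound Δt U ε)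
    -- stage cost, horizon, growth bounds
    (Q : Matrix (Fin n) (Fin n) ℝ) (hQ : Q.PosDef)
    (R : Matrix (Fin m) (Fin m) ℝ) (hR : R.PosDef)
    (N : ℕ) (hN : 2 ≤ N)
    (B : ℕ → ℝ) (hBmono : MonotoneOn B (Set.Ici 1)) (hBbdd : BddAbove (B '' Set.Ici 1))
    (hα : subopt B N ∈ Set.Ioo 0 1)
    -- the set `S` and the margin `η`
    (S : Set (Vec n)) (hS : S ⊆ tighten X ε₀) (hS0 : (0 : Vec n) ∈ interior S)
    (η : ℝ) (hη : 0 < η)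
    (hmargin : ∀ ε ∈ Set.Ioc 0 ε₀, ∀ x ∈ S, ∃ u,
      IsOptimal ((model ε).surrogate Δt) Q R (tighten X ε) U N x u ∧
      ∀ k ≤ N, traj ((model ε).surrogate Δt) u x k ∈ tighten X (ε + η))
    -- `opt ε x` is the optimal control sequence computed by the EDMD-based MPC algorithm at `x`
    (opt : ℝ → Vec n → ℕ → Vec m)
    (hopt : ∀ ε ∈ Set.Ioc 0 ε₀, ∀ x ∈ S,
      IsOptimal ((model ε).surrogate Δt) Q R (tighten X ε) U N x (opt ε x))
    -- forward invariance of `S` for the surrogate closed loop, with margin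
    (hforward : ∀ ε ∈ Set.Ioc 0 ε₀, ∀ x ∈ S,
      (model ε).surrogate Δt x (opt ε x 0) ∈ tighten S η)
    -- cost controllability on `S` and along the optimal open-loop trajectories from `S`
    (hcc : ∀ ε ∈ Set.Ioc 0 ε₀, ∀ x ∈ S, ∀ k < N,
      CostControllableAt (sys.sampled Δt) ((model ε).surrogate Δt) Q R X (tighten X ε) U N B
        (traj ((model ε).surrogate Δt) (opt ε x) x k)) :
    SemigloballyPracticallyAsymptoticallyStable
      (fun ε x => sys.sampled Δt x (opt ε x 0)) S := by
  have hmem : (0 : Vec n) ∈ X ∧ (0 : Vec m) ∈ U := Set.mem_prod.1 (interior_subset h0)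
  rcases subsingleton_or_nontrivial (Vec n) with hn | hn
  · exact semigloballyPracticallyAsymptoticallyStable_of_subsingleton _ _
  have hε₀mem : ε₀ ∈ Set.Ioc 0 ε₀ := ⟨hε₀, le_rfl⟩
  obtain ⟨cΨ, hcΨ⟩ := hX.exists_bound_of_continuousOn
    dict.contDiff_toLp_Ψ.continuous.continuousOn
  obtain ⟨LΨ, hLΨ⟩ := (dict.contDiff_toLp_Ψ.locallyLipschitz.locallyLipschitzOn
    ).exists_lipschitzOnWith_of_compact hX
  obtain ⟨cE, hcE⟩ := hU.exists_bound_of_continuousOn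
    ((model ε₀).continuous_norm_propagator (Δt := Δt)).continuousOn
  have hc : 0 ≤ cΨ := (norm_nonneg _).trans (hcΨ 0 hmem.1)
  have hE0 : 0 ≤ cE := (norm_nonneg _).trans (hcE 0 hmem.2)
  refine semigloballyPracticallyAsymptoticallyStable_of_approximation
    (F := fun ε => (model ε).surrogate Δt) (L := (cE + 2 * ε₀) * LΨ) (c := cΨ) hX.isBounded
    hmem.2 hε₀ (by positivity) hc (fun ε hε x hx u hu => ?_) (fun ε hε x hx y hy u hu => ?_)
    hQ hR hN hBmono hα.1 (hS.trans (tighten_subset hε₀)) hS0 hη hmargin hopt hforward hcc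
  · refine ((model ε).norm_sampled_sub_surrogate_le hinv (hbound ε hε) hx hu).trans ?_
    rw [mul_comm]
    exact mul_le_mul_of_nonneg_right (hcΨ x hx) hε.1.le
  · refine ((model ε).norm_surrogate_sub_surrogate_le x y u).trans ?_
    rw [mul_assoc]
    -- The Lipschitz constant must not depend on `ε`: passing through the Koopman matrix, the
    -- propagator norm for `ε` is at most the one for `ε₀` plus `ε + ε₀`, hence at most `cE + 2 *
    -- ε₀`.
    have h1 := hbound ε hε u hu
    have h2 := hbound ε₀ hε₀mem u hu
    have h3 := hcE u hu
    rw [norm_norm] at h3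
    rw [map_sub] at h1 h2
    have h4 := norm_sub_norm_le (Matrix.toEuclideanCLM (𝕜 := ℝ) ((model ε).propagator Δt u))
      (Matrix.toEuclideanCLM (𝕜 := ℝ) (dict.koopmanMatrix (sys.sampled Δt) X u))
    have h5 := norm_sub_norm_le
      (Matrix.toEuclideanCLM (𝕜 := ℝ) (dict.koopmanMatrix (sys.sampled Δt) X u))
      (Matrix.toEuclideanCLM (𝕜 := ℝ) ((model ε₀).propagator Δt u))
    rw [norm_sub_rev] at h4
    have h6 := hLΨ.norm_sub_le hx hy
    have h7 := hε.2
    exact mul_le_mul (by linarith) h6 (norm_nonneg _) (by linarith)
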